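/- All graphs are finite, undirected and simple. For a graph $G$, let $\rho(G)$ denote the largest eigenvalue of its adjacency matrix. Write $K_m$ for the complete graph of order $m$ ($K_0$ being the graph without vertices), $G_1+G_2$ for the disjoint union of two graphs, and $G_1\vee G_2$ for their join, obtained from $G_1+G_2$ by adding all edges between $V(G_1)$ and $V(G_2)$. For positive integers $a\le b$, a fractional $[a,b]$-factor of $G$ with indicator function $h:E(G)\to[0,1]$ is the spanning subgraph of $G$ with edge set $\{e\in E(G): h(e)>0\}$, where $h$ satisfies $a\le\sum_{e\ni v}h(e)\le b$ for every vertex $v$ of $G$ (the sum being over the edges of $G$ incident with $v$). **Theorem.** Let $a\le b$ be positive integers and let $G$ be a graph of order $n\ge a+1$, where $na$ is even if $a=b$. If $$\rho(G)\ \ge\ \rho\bigl(K_{a-1}\vee(K_{n-a}+K_1)\bigr),$$ then $G$ has a fractional $[a,b]$-factor unless $G\cong K_{a-1}\vee(K_{n-a}+K_1)$; in the exceptional case $G$ has no fractional $[a,b]$-factor. -/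

import Mathlib

namespace SimpleGraph

/-- The join `G ∨ H`: the disjoint union of `G` and `H` together with all edges between the two
vertex sets. -/
def graphJoin {V W : Type*} (G : SimpleGraph V) (H : SimpleGraph W) : SimpleGraph (V ⊕ W) :=
  (G ⊕g H) ⊔ completeBipartiteGraph V W

/-- The graph `K_{a-1} ∨ (K_{n-a} + K_1)`, of order `n` when `1 ≤ a ≤ n - 1`. -/
def extremalGraph (n a : ℕ) : SimpleGraph (Fin (a - 1) ⊕ (Fin (n - a) ⊕ Fin 1)) :=
  graphJoin (completeGraph (Fin (a - 1))) (completeGraph (Fin (n - a)) ⊕g completeGraph (Fin 1))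

open Classical in
/-- The largest eigenvalue of the adjacency matrix of a finite graph. -/
noncomputable def adjSpectralRadius {V : Type*} [Fintype V] (G : SimpleGraph V) : ℝ :=
  sSup {μ : ℝ | Module.End.HasEigenvalue (G.adjMatrix ℝ).mulVecLin μ}

open Classical in
/-- `F` is the fractional `(g, f)`-factor of `G` with indicator function `h : E(G) → [0, 1]`:
the sum of `h` over the edges of `G` at each vertex `v` lies between `g v` and `f v`, and `F` is the
spanning subgraph of `G` whose edges are the edges of `G` on which `h` is positive. -/
structure IsFractionalFactor {V : Type*} [Fintype V] (G : SimpleGraph V) (g f : V → ℕ)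
    (h : G.edgeSet → ℝ) (F : SimpleGraph V) : Prop where
  mem_Icc : ∀ e, h e ∈ Set.Icc (0 : ℝ) 1
  lower : ∀ v, (g v : ℝ) ≤ ∑ e ∈ Finset.univ.filter (fun e : G.edgeSet => v ∈ e.1), h e
  upper : ∀ v, ∑ e ∈ Finset.univ.filter (fun e : G.edgeSet => v ∈ e.1), h e ≤ (f v : ℝ)
  edgeSet_eq : F.edgeSet = {e | ∃ he : e ∈ G.edgeSet, 0 < h ⟨e, he⟩}

/-- `G` has a fractional `[a, b]`-factor. -/
def HasFractionalFactor {V : Type*} [Fintype V] (G : SimpleGraph V) (a b : ℕ) : Prop :=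
  ∃ (h : G.edgeSet → ℝ) (F : SimpleGraph V),
    IsFractionalFactor G (fun _ => a) (fun _ => b) h F

end SimpleGraph

/-! Let H be the extremal graph, that is, K_n without the edges from one vertex v to the complement
of a set N of a - 1 further vertices. Its vertex v has degree a - 1, so weights at most 1 cannot
reach the sum a there.

Now suppose that G has no factor and ρ(G) ≥ ρ(H). If some degree is below a, then G lies in a copy
of H, and strict monotonicity of ρ (`eq_nearComplete_of_le`) makes it that copy. Otherwise all
degrees are at least a, and duality gives disjoint S, T with b|S| + ∑_{u ∈ T} |N(u) \ S| < a|T|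
(`exists_barrier_of_not_hasFractionalFactor`). The degree condition forces S to be nonempty and |T|
> b, and counting edges across S, T and the rest bounds the degree sum by (n-1)(n-2) + a
(`degree_sum_bound_of_barrier`). Counting walks of length two gives ρ² - (a-1)ρ ≤ ∑ d(v) - (n-1)a
(`adjSpectralRadius_sq_le`), which contradicts ρ(G) ≥ ρ(H) > n - 2. For a = 1 only ρ(H) ≥ n - 2 is
available, and a sharper edge count makes up for it. -/

namespace Matrix

/-! ### Rayleigh quotients of real matrices. -/

variable {V : Type*} [Fintype V]

/-- The quadratic form of a real matrix attains its maximum on the unit sphere. -/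
lemma exists_rayleigh_max [Nonempty V] (A : Matrix V V ℝ) :
    ∃ x : V → ℝ, x ⬝ᵥ x = 1 ∧ ∀ y : V → ℝ, y ⬝ᵥ A *ᵥ y ≤ (x ⬝ᵥ A *ᵥ x) * (y ⬝ᵥ y) := by
  classical
  have hcompact : IsCompact {x : V → ℝ | x ⬝ᵥ x = 1} := by
    refine Metric.isCompact_of_isClosed_isBounded ?_ ?_
    · exact isClosed_eq (by unfold dotProduct; fun_prop) continuous_const
    · refine (Metric.isBounded_closedBall (x := (0 : V → ℝ)) (r := 1)).subset ?_
      intro x hx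
      rw [mem_closedBall_zero_iff, pi_norm_le_iff_of_nonneg zero_le_one]
      intro v
      have h1 : x v * x v ≤ x ⬝ᵥ x :=
        Finset.single_le_sum (f := fun v => x v * x v) (fun i _ => mul_self_nonneg _)
          (Finset.mem_univ v)
      rw [Set.mem_ofPred_eq.mp hx] at h1
      rw [Real.norm_eq_abs]
      exact abs_le_one_iff_mul_self_le_one.mpr h1
  obtain ⟨v⟩ := ‹Nonempty V›
  obtain ⟨x, hx, hmax⟩ := hcompact.exists_isMaxOn ⟨Pi.single v 1, by simp⟩
    (f := fun x => x ⬝ᵥ A *ᵥ x)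
    (by unfold mulVec dotProduct; fun_prop)
  refine ⟨x, hx, fun y => ?_⟩
  by_cases hy : y = 0
  · simp [hy]
  have hpos : 0 < y ⬝ᵥ y := by
    have h0 : 0 ≤ y ⬝ᵥ y := Finset.sum_nonneg fun i _ => mul_self_nonneg _
    exact lt_of_le_of_ne h0 fun h => hy (dotProduct_self_eq_zero.mp h.symm)
  have hs := Real.mul_self_sqrt hpos.le
  have hs0 := Real.sqrt_pos.mpr hpos
  set r := √(y ⬝ᵥ y)
  have hmem : r⁻¹ • y ∈ {x : V → ℝ | x ⬝ᵥ x = 1} := by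
    simp only [Set.mem_ofPred_eq, smul_dotProduct, dotProduct_smul, smul_eq_mul, ← hs]
    field_simp
  have h := hmax hmem
  simp only [Set.mem_ofPred_eq, mulVec_smul, smul_dotProduct, dotProduct_smul, smul_eq_mul] at h
  rw [← hs]
  calc y ⬝ᵥ A *ᵥ y = (r⁻¹ * (r⁻¹ * (y ⬝ᵥ A *ᵥ y))) * (r * r) := by field_simp
    _ ≤ _ := mul_le_mul_of_nonneg_right h (by positivity)

/-- A vector that attains the maximum of the Rayleigh quotient is an eigenvector. -/
lemma mulVec_eq_smul_of_rayleigh_max [DecidableEq V] {A : Matrix V V ℝ} (hA : A.IsSymm) {μ : ℝ}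
    (hμ : ∀ y : V → ℝ, y ⬝ᵥ A *ᵥ y ≤ μ * (y ⬝ᵥ y)) {x : V → ℝ}
    (hx : x ⬝ᵥ A *ᵥ x = μ * (x ⬝ᵥ x)) : A *ᵥ x = μ • x := by
  -- A positive semidefinite form vanishes only on the kernel of its matrix.
  have hps : (μ • (1 : Matrix V V ℝ) - A).PosSemidef := by
    refine PosSemidef.of_dotProduct_mulVec_nonneg ?_ fun y => ?_
    · ext i j
      simp [one_apply, hA.apply i j, eq_comm]
    · simp only [star_trivial, sub_mulVec, smul_mulVec, one_mulVec, dotProduct_sub,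
        dotProduct_smul, smul_eq_mul]
      linarith [hμ y]
  have h := (hps.dotProduct_mulVec_zero_iff x).mp (by
    simp only [star_trivial, sub_mulVec, smul_mulVec, one_mulVec, dotProduct_sub,
      dotProduct_smul, smul_eq_mul]
    linarith)
  rw [sub_mulVec, smul_mulVec, one_mulVec] at h
  exact (sub_eq_zero.mp h).symm

end Matrix

/-! ### The largest eigenvalue and its bound by degrees. -/

namespace SimpleGraph

open Matrix

variable {V : Type*} [Fintype V]

-- The weak half of Perron–Frobenius: adjacency entries are nonnegative, so replacing a maximiser x
-- by |x| keeps the norm and does not decrease the form. No connectedness is needed, but zeros of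
-- the vector remain possible.
open Classical in
lemma exists_nonneg_top_eigenvector [Nonempty V] (G : SimpleGraph V) :
    (∀ y : V → ℝ, y ⬝ᵥ G.adjMatrix ℝ *ᵥ y ≤ G.adjSpectralRadius * (y ⬝ᵥ y)) ∧
    ∃ x : V → ℝ, (∀ v, 0 ≤ x v) ∧ x ≠ 0 ∧
      G.adjMatrix ℝ *ᵥ x = G.adjSpectralRadius • x := by
  obtain ⟨x, hx1, hmax⟩ := exists_rayleigh_max (G.adjMatrix ℝ)
  set μ := x ⬝ᵥ G.adjMatrix ℝ *ᵥ x with hμ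
  have habs1 : |x| ⬝ᵥ |x| = 1 := by
    rw [← hx1]
    simp [dotProduct]
  have habs : |x| ⬝ᵥ G.adjMatrix ℝ *ᵥ |x| = μ * (|x| ⬝ᵥ |x|) := by
    refine le_antisymm (hmax _) ?_
    rw [habs1, mul_one, hμ]
    simp only [dotProduct, mulVec, Finset.mul_sum]
    refine Finset.sum_le_sum fun i _ => Finset.sum_le_sum fun j _ => ?_
    simp only [adjMatrix_apply, Pi.abs_apply]
    split_ifs
    · rw [one_mul, one_mul, ← abs_mul]
      exact le_abs_self _
    · simp
  have hev := mulVec_eq_smul_of_rayleigh_max (G.isSymm_adjMatrix (α := ℝ)) hmax habs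
  have hne : |x| ≠ 0 := by
    intro h
    rw [h] at habs1
    simp at habs1
  have hρ : G.adjSpectralRadius = μ := by
    refine IsGreatest.csSup_eq ⟨?_, ?_⟩
    · exact Module.End.hasEigenvalue_of_hasEigenvector
        (Module.End.hasEigenvector_iff.mpr ⟨Module.End.mem_eigenspace_iff.mpr (by simpa using hev), hne⟩)
    · intro ν hν
      obtain ⟨y, hy⟩ := hν.exists_hasEigenvector
      have h1 : G.adjMatrix ℝ *ᵥ y = ν • y := by simpa using hy.apply_eq_smul
      have h2 := hmax y
      rw [h1, dotProduct_smul, smul_eq_mul] at h2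
      have h0 : 0 ≤ y ⬝ᵥ y := Finset.sum_nonneg fun i _ => mul_self_nonneg _
      have hpos : 0 < y ⬝ᵥ y :=
        lt_of_le_of_ne h0 fun h => hy.2 (dotProduct_self_eq_zero.mp h.symm)
      exact le_of_mul_le_mul_right h2 hpos
  rw [hρ]
  exact ⟨hmax, |x|, fun v => abs_nonneg _, hne, hev⟩

lemma adjSpectralRadius_le_of_iso {W : Type*} [Fintype W] [Nonempty V] {G : SimpleGraph V}
    {H : SimpleGraph W} (e : G ≃g H) : H.adjSpectralRadius ≤ G.adjSpectralRadius := by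
  classical
  have : Nonempty W := ⟨e (Classical.arbitrary V)⟩
  obtain ⟨x, -, hx0, hx⟩ := H.exists_nonneg_top_eigenvector.2
  have h := G.exists_nonneg_top_eigenvector.1 (x ∘ e)
  have h1 : (x ∘ e) ⬝ᵥ (x ∘ e) = x ⬝ᵥ x :=
    Equiv.sum_comp e.toEquiv fun w => x w * x w
  have h2 : G.adjMatrix ℝ *ᵥ (x ∘ e) = (H.adjMatrix ℝ *ᵥ x) ∘ e := by
    ext v
    simp only [mulVec, dotProduct, Function.comp_apply, adjMatrix_apply]
    rw [← Equiv.sum_comp e.toEquiv]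
    exact Finset.sum_congr rfl fun w _ => by
      simp only [RelIso.coe_fn_toEquiv, e.map_adj_iff]
  rw [h1, h2, hx] at h
  have h3 : (x ∘ e) ⬝ᵥ (H.adjSpectralRadius • x) ∘ e = H.adjSpectralRadius * (x ⬝ᵥ x) := by
    rw [← smul_eq_mul, ← dotProduct_smul]
    exact Equiv.sum_comp e.toEquiv fun w => x w * (H.adjSpectralRadius • x) w
  rw [h3] at h
  have h0 : 0 ≤ x ⬝ᵥ x := Finset.sum_nonneg fun i _ => mul_self_nonneg _
  exact le_of_mul_le_mul_right h
    (lt_of_le_of_ne h0 fun h => hx0 (dotProduct_self_eq_zero.mp h.symm))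

open Classical in
/-- If every degree is at least `k`, then `ρ² - (k - 1) ρ ≤ ∑ d(v) - (n - 1) k`. -/
lemma adjSpectralRadius_sq_le [Nonempty V] (G : SimpleGraph V) {k : ℕ}
    (hk : ∀ v, k ≤ G.degree v) :
    G.adjSpectralRadius ^ 2 - (k - 1) * G.adjSpectralRadius ≤
      ∑ v, (G.degree v : ℝ) - (Fintype.card V - 1) * k := by
  obtain ⟨x, hx, hx0, hev⟩ := G.exists_nonneg_top_eigenvector.2
  set ρ := G.adjSpectralRadius
  have hev' : ∀ v, ∑ w ∈ G.neighborFinset v, x w = ρ * x v := fun v => by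
    have := congrFun hev v
    rwa [adjMatrix_mulVec_apply] at this
  -- Self-adjointness of the adjacency matrix against x. Taking f = 1 and then f = degree gives ρ² ∑
  -- x as a sum over v of x(v) times the number of walks of length two from v.
  have hswap : ∀ f : V → ℝ,
      ∑ v, (∑ u ∈ G.neighborFinset v, f u) * x v = ρ * ∑ v, f v * x v := by
    intro f
    calc ∑ v, (∑ u ∈ G.neighborFinset v, f u) * x v
        = ∑ v, ∑ u ∈ G.neighborFinset v, f u * x v := by simp_rw [Finset.sum_mul]
      _ = ∑ u, ∑ v ∈ G.neighborFinset u, f u * x v :=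
          Finset.sum_comm' (by simp [G.adj_comm])
      _ = ρ * ∑ v, f v * x v := by
          rw [Finset.mul_sum]
          refine Finset.sum_congr rfl fun u _ => ?_
          rw [← Finset.mul_sum, hev']
          ring
  have hd1 : ∑ v, (G.degree v : ℝ) * x v = ρ * ∑ v, x v := by
    have := hswap fun _ => 1
    simpa using this
  have hd2 := hswap fun v => (G.degree v : ℝ)
  rw [hd1] at hd2
  set D := ∑ v, (G.degree v : ℝ) with hD
  set n : ℝ := (Fintype.card V : ℝ) with hn
  -- From the total D, remove d(v) and at least k for each of the n - 1 - d(v) other non-neighbours.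
  have hpt : ∀ v, ∑ u ∈ G.neighborFinset v, (G.degree u : ℝ) ≤
      D - (n - 1) * k + (k - 1) * G.degree v := by
    intro v
    have hsplit : ∑ u ∈ (G.neighborFinset v)ᶜ, (G.degree u : ℝ) +
        ∑ u ∈ G.neighborFinset v, (G.degree u : ℝ) = D :=
      Finset.sum_compl_add_sum _ _
    have hv : v ∈ (G.neighborFinset v)ᶜ := by simp
    have hrest : (n - 1 - G.degree v) * k ≤
        ∑ u ∈ (G.neighborFinset v)ᶜ.erase v, (G.degree u : ℝ) := by
      have hc : (((G.neighborFinset v)ᶜ.erase v).card : ℝ) = n - 1 - G.degree v := by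
        rw [Finset.cast_card_erase_of_mem hv, Finset.card_compl, Nat.cast_sub (Finset.card_le_univ _),
          card_neighborFinset_eq_degree]
        ring
      rw [← hc, ← nsmul_eq_mul]
      exact Finset.card_nsmul_le_sum _ _ _ fun u _ => by exact_mod_cast hk u
    rw [← Finset.add_sum_erase _ _ hv] at hsplit
    linarith
  have hsum : ρ * (ρ * ∑ v, x v) ≤
      (D - (n - 1) * k) * ∑ v, x v + (k - 1) * (ρ * ∑ v, x v) := by
    rw [← hd2, ← hd1, Finset.mul_sum, Finset.mul_sum, ← Finset.sum_add_distrib]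
    refine Finset.sum_le_sum fun v _ => ?_
    nlinarith [mul_le_mul_of_nonneg_right (hpt v) (hx v)]
  have hpos : 0 < ∑ v, x v := by
    obtain ⟨v, hv⟩ := Function.ne_iff.mp hx0
    exact Finset.sum_pos' (fun i _ => hx i) ⟨v, Finset.mem_univ v, lt_of_le_of_ne (hx v) hv.symm⟩
  refine le_of_mul_le_mul_right ?_ hpos
  linarith

end SimpleGraph

/-! ### Fractional factors: the barrier criterion by duality. -/

namespace SimpleGraph

open MeasureTheory

lemma setIntegral_indicator_Ioc {r s M : ℝ} (hr : 0 ≤ r) (hs : s ≤ M) :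
    ∫ θ in Set.Ioc 0 M, (Set.Ioc r s).indicator (fun _ => (1 : ℝ)) θ = max (s - r) 0 := by
  rw [setIntegral_indicator measurableSet_Ioc,
    Set.inter_eq_right.mpr (Set.Ioc_subset_Ioc hr hs), setIntegral_const, smul_eq_mul, mul_one,
    Real.volume_real_Ioc]

variable {V : Type*} [Fintype V]

open Classical in
/-- Layer-cake form of the inequalities `a |T| ≤ b |S| + ∑_{u ∈ T} |N(u) \ S|`. -/
lemma layer_cake_inequality (G : SimpleGraph V) {a b : ℕ}
    (hST : ∀ S T : Finset V, Disjoint S T →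
      a * T.card ≤ b * S.card + ∑ u ∈ T, (G.neighborFinset u \ S).card) (c : V → ℝ) :
    ∑ v, a * max (c v) 0 ≤ ∑ v, b * max (-c v) 0 +
      ∑ u, ∑ w ∈ G.neighborFinset u, max (c u - max (-c w) 0) 0 := by
  obtain ⟨M, hM⟩ : ∃ M, ∀ v, |c v| ≤ M :=
    ⟨∑ v, |c v|, fun v => Finset.single_le_sum (f := fun v => |c v|) (fun _ _ => abs_nonneg _)
      (Finset.mem_univ v)⟩
  have hM1 : ∀ v, c v ≤ M := fun v => (le_abs_self _).trans (hM v)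
  have hM2 : ∀ v, -c v ≤ M := fun v => (neg_le_abs _).trans (hM v)
  have hint : ∀ r s : ℝ, IntegrableOn ((Set.Ioc r s).indicator fun _ => (1 : ℝ))
      (Set.Ioc 0 M) := fun r s =>
    (integrableOn_const (by simp)).indicator measurableSet_Ioc
  have key : ∫ θ in Set.Ioc 0 M, ∑ v, a * (Set.Ioc 0 (c v)).indicator (fun _ => (1 : ℝ)) θ ≤
      ∫ θ in Set.Ioc 0 M, (∑ v, b * (Set.Ioc 0 (-c v)).indicator (fun _ => (1 : ℝ)) θ +
        ∑ u, ∑ w ∈ G.neighborFinset u,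
          (Set.Ioc (max (-c w) 0) (c u)).indicator (fun _ => (1 : ℝ)) θ) := by
    refine setIntegral_mono_on ?_ ?_ measurableSet_Ioc ?_
    · exact integrable_finsetSum _ fun v _ => (hint _ _).const_mul _
    · exact (integrable_finsetSum _ fun v _ => (hint _ _).const_mul _).add
        (integrable_finsetSum _ fun u _ => integrable_finsetSum _ fun w _ => hint _ _)
    · intro θ hθ
      have h0 : 0 < θ := hθ.1
      -- At level θ take S = {c ≤ -θ} and T = {c ≥ θ}; the pair u ∈ T, w ∉ S occurs exactly for θ in
      -- (max(-c w, 0), c u].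
      have h := hST (Finset.univ.filter fun v => θ ≤ -c v) (Finset.univ.filter fun v => θ ≤ c v) (by
        rw [Finset.disjoint_filter]
        intro v _ h1 h2
        linarith)
      have h' : (a : ℝ) * ((Finset.univ.filter fun v => θ ≤ c v).card : ℝ) ≤
          b * ((Finset.univ.filter fun v => θ ≤ -c v).card : ℝ) +
          ∑ u ∈ Finset.univ.filter fun v => θ ≤ c v,
            ((G.neighborFinset u \ Finset.univ.filter fun v => θ ≤ -c v).card : ℝ) := by
        exact_mod_cast h
      simp only [Set.indicator_apply, Set.mem_Ioc, h0, true_and, max_lt_iff, and_true,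
        ← Finset.mul_sum, Finset.sum_boole]
      refine h'.trans_eq ?_
      rw [Finset.sum_filter]
      congr 1
      refine Finset.sum_congr rfl fun u _ => ?_
      split_ifs with hu
      · congr 2
        ext w
        simp [hu]
      · simp [hu]
  rw [integral_add (integrable_finsetSum _ fun v _ => (hint _ _).const_mul _)
      (integrable_finsetSum _ fun u _ => integrable_finsetSum _ fun w _ => hint _ _),
    integral_finsetSum _ fun v _ => (hint _ _).const_mul _,
    integral_finsetSum _ fun v _ => (hint _ _).const_mul _,
    integral_finsetSum _ fun u _ => integrable_finsetSum _ fun w _ => hint _ _] at key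
  simp only [integral_const_mul, setIntegral_indicator_Ioc le_rfl (hM1 _),
    setIntegral_indicator_Ioc le_rfl (hM2 _), sub_zero] at key
  refine key.trans_eq ?_
  congr 1
  refine Finset.sum_congr rfl fun u _ => ?_
  rw [integral_finsetSum _ fun w _ => hint _ _]
  exact Finset.sum_congr rfl fun w _ => setIntegral_indicator_Ioc (le_max_right _ _) (hM1 _)

open Classical in
lemma sum_edgeSet_filter_mem (G : SimpleGraph V) (k : Sym2 V → ℝ) (v : V) :
    ∑ e ∈ Finset.univ.filter (fun e : G.edgeSet => v ∈ e.1), k e.1 =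
      ∑ w ∈ G.neighborFinset v, k s(v, w) := by
  symm
  refine Finset.sum_bij (fun w hw => ⟨s(v, w), by simpa using hw⟩) ?_ ?_ ?_ ?_
  · simp
  · intro w _ w' _ h
    exact Sym2.congr_right.mp (Subtype.mk.inj h)
  · rintro ⟨e, he⟩ hv
    obtain ⟨w, rfl⟩ := Sym2.mem_iff_exists.mp (Finset.mem_filter.mp hv).2
    exact ⟨w, by simpa using he, rfl⟩
  · simp

open Classical in
/-- A graph without a fractional `[a, b]`-factor has disjoint vertex sets `S`, `T` with
`b |S| + ∑_{u ∈ T} |N(u) \ S| < a |T|`. -/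
lemma exists_barrier_of_not_hasFractionalFactor (G : SimpleGraph V) {a b : ℕ} (hab : a ≤ b)
    (hG : ¬ G.HasFractionalFactor a b) :
    ∃ S T : Finset V, Disjoint S T ∧
      b * S.card + ∑ u ∈ T, (G.neighborFinset u \ S).card < a * T.card := by
  by_contra! hST
  apply hG
  let d : (G.edgeSet → ℝ) →ₗ[ℝ] (V → ℝ) :=
    { toFun := fun h v => ∑ e ∈ Finset.univ.filter (fun e : G.edgeSet => v ∈ e.1), h e
      map_add' := fun x y => by ext v; simp [Finset.sum_add_distrib]
      map_smul' := fun r x => by ext v; simp [Finset.mul_sum] }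
  have hd : ∀ h v, d h v = ∑ e ∈ Finset.univ.filter (fun e : G.edgeSet => v ∈ e.1), h e :=
    fun _ _ => rfl
  suffices hmeet : ¬ Disjoint (d '' Set.Icc 0 1)
      (Set.Icc (fun _ => (a : ℝ)) (fun _ => (b : ℝ))) by
    obtain ⟨_, ⟨h, hh, rfl⟩, hq⟩ := Set.not_disjoint_iff.mp hmeet
    refine ⟨h, fromEdgeSet {e | ∃ he : e ∈ G.edgeSet, 0 < h ⟨e, he⟩},
      fun e => ⟨hh.1 e, hh.2 e⟩, fun v => hq.1 v, fun v => hq.2 v, ?_⟩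
    rw [edgeSet_fromEdgeSet, sdiff_eq_left, Set.disjoint_left]
    rintro e ⟨he, -⟩
    exact G.not_isDiag_of_mem_edgeSet he
  intro hdisj
  obtain ⟨f, u, w, hu, huw, hw⟩ := geometric_hahn_banach_compact_closed
    ((convex_Icc (0 : G.edgeSet → ℝ) 1).linear_image d)
    (isCompact_Icc.image (LinearMap.continuous_of_finiteDimensional d))
    (convex_Icc _ _) isClosed_Icc hdisj
  set c : V → ℝ := fun v => f (Pi.single v 1) with hc
  have hf : ∀ p : V → ℝ, f p = ∑ v, p v * c v := by
    intro p
    conv_lhs => rw [pi_eq_sum_univ' p, map_sum]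
    refine Finset.sum_congr rfl fun v _ => ?_
    rw [map_smul, smul_eq_mul]
  -- The weight in the cube that maximises the separating functional, in which edge xy has
  -- coefficient c x + c y.
  let k : Sym2 V → ℝ := Sym2.lift ⟨fun x y => if 0 < c x + c y then 1 else 0, fun x y => by
    simp only [add_comm]⟩
  have hk : ∀ x y, k s(x, y) = if 0 < c x + c y then 1 else 0 := fun _ _ => rfl
  have h1 := hu (d fun e => k e.1) ⟨_, ⟨fun e => ?_, fun e => ?_⟩, rfl⟩
  rotate_left
  · obtain ⟨e, he⟩ := e
    induction e with
    | _ x y => simp only [hk]; split_ifs <;> simp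
  · obtain ⟨e, he⟩ := e
    induction e with
    | _ x y => simp only [hk]; split_ifs <;> simp
  -- The minimiser of the functional over the box. Separation puts its value above that of `k`; the
  -- layer-cake inequality says the opposite.
  have h2 := hw (fun v => if 0 < c v then (a : ℝ) else b) ⟨fun v => ?_, fun v => ?_⟩
  rotate_left
  · dsimp only
    split_ifs
    · exact le_rfl
    · exact_mod_cast hab
  · dsimp only
    split_ifs
    · exact_mod_cast hab
    · exact le_rfl
  rw [hf] at h1 h2
  have hlay := layer_cake_inequality G hST c
  have e2 : ∑ v, (if 0 < c v then (a : ℝ) else b) * c v =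
      ∑ v, a * max (c v) 0 - ∑ v, b * max (-c v) 0 := by
    rw [← Finset.sum_sub_distrib]
    refine Finset.sum_congr rfl fun v _ => ?_
    split_ifs with h
    · rw [max_eq_left h.le, max_eq_right (by linarith)]
      ring
    · rw [max_eq_right (by linarith), max_eq_left (by linarith)]
      ring
  have hsym : ∀ F : V → V → ℝ, ∑ x, ∑ y ∈ G.neighborFinset x, F x y =
      ∑ x, ∑ y ∈ G.neighborFinset x, F y x := fun F =>
    Finset.sum_comm' (by simp [G.adj_comm])
  have e1 : ∑ v, d (fun e => k e.1) v * c v =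
      ∑ u, ∑ w ∈ G.neighborFinset u, max (c u - max (-c w) 0) 0 := by
    have hl : ∑ v, d (fun e => k e.1) v * c v =
        ∑ x, ∑ y ∈ G.neighborFinset x, (if 0 < c x + c y then 1 else 0) * c x := by
      refine Finset.sum_congr rfl fun v _ => ?_
      rw [hd, sum_edgeSet_filter_mem, Finset.sum_mul]
      rfl
    -- The two sums agree only after both orientations of an edge are added; each side is then max(c
    -- x + c y, 0) unless both values are positive, where it is still c x + c y.
    have hpt : ∀ x y, (if 0 < c x + c y then 1 else 0) * c x +
        (if 0 < c y + c x then 1 else 0) * c y =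
        max (c x - max (-c y) 0) 0 + max (c y - max (-c x) 0) 0 := by
      intro x y
      rw [add_comm (c y)]
      simp only [max_def]
      split_ifs <;> linarith
    have hd1 : ∑ x, ∑ y ∈ G.neighborFinset x, (if 0 < c x + c y then 1 else 0) * c x +
        ∑ x, ∑ y ∈ G.neighborFinset x, (if 0 < c y + c x then 1 else 0) * c y =
        ∑ x, ∑ y ∈ G.neighborFinset x, max (c x - max (-c y) 0) 0 +
        ∑ x, ∑ y ∈ G.neighborFinset x, max (c y - max (-c x) 0) 0 := by
      simp only [← Finset.sum_add_distrib, hpt]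
    rw [hl]
    rw [← hsym fun x y => (if 0 < c x + c y then 1 else 0) * c x,
      ← hsym fun x y => max (c x - max (-c y) 0) 0] at hd1
    linarith
  linarith

end SimpleGraph

/-! ### The extremal graph and its spectral radius. -/

namespace SimpleGraph

open Matrix

variable {V : Type*}

/-- The complete graph with the edges from `v` to the complement of `N` removed. -/
def nearComplete (v : V) (N : Finset V) : SimpleGraph V where
  Adj p q := p ≠ q ∧ (p = v → q ∈ N) ∧ (q = v → p ∈ N)
  symm := ⟨fun _ _ h => ⟨h.1.symm, h.2.2, h.2.1⟩⟩
  loopless := ⟨fun _ h => h.1 rfl⟩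

lemma extremalGraph_adj {n a : ℕ} (p q : Fin (a - 1) ⊕ (Fin (n - a) ⊕ Fin 1)) :
    (extremalGraph n a).Adj p q ↔ p ≠ q ∧ (p = .inr (.inr 0) → q.isLeft) ∧
      (q = .inr (.inr 0) → p.isLeft) := by
  rcases p with p | p | p <;> rcases q with q | q | q <;>
    simp [extremalGraph, graphJoin, Fin.fin_one_eq_zero]

variable [Fintype V]

lemma nonempty_nearComplete_iso_extremalGraph {n a : ℕ} (ha : 1 ≤ a) (hcard : Fintype.card V = n)
    {v : V} {N : Finset V} (hv : v ∉ N) (hN : N.card = a - 1) :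
    Nonempty (nearComplete v N ≃g extremalGraph n a) := by
  classical
  let e1 : {x // x ∈ N} ≃ Fin (a - 1) := Fintype.equivFinOfCardEq (by simpa using hN)
  have hc0 : Fintype.card {x // x ∉ N} = n - (a - 1) := by
    rw [Fintype.card_subtype_compl, hcard]
    simp [hN]
  have hc : Fintype.card {y : {x // x ∉ N} // ¬ y = ⟨v, hv⟩} = n - a := by
    rw [Fintype.card_subtype_compl, hc0, Fintype.card_subtype_eq]
    omega
  let e2 : {y : {x // x ∉ N} // ¬ y = ⟨v, hv⟩} ≃ Fin (n - a) := Fintype.equivFinOfCardEq hc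
  let e3 : {y : {x // x ∉ N} // y = ⟨v, hv⟩} ≃ Fin 1 :=
    Fintype.equivFinOfCardEq (Fintype.card_subtype_eq _)
  let e : V ≃ Fin (a - 1) ⊕ (Fin (n - a) ⊕ Fin 1) :=
    (Equiv.sumCompl (· ∈ N)).symm.trans (Equiv.sumCongr e1
      ((Equiv.sumCompl (· = ⟨v, hv⟩)).symm.trans ((Equiv.sumComm _ _).trans (Equiv.sumCongr e2 e3))))
  have hev : e v = .inr (.inr 0) := by
    simp [e, Equiv.sumCompl_symm_apply_of_neg, hv, Equiv.sumCompl_symm_apply_of_pos,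
      Fin.fin_one_eq_zero]
  have heN : ∀ x, (e x).isLeft ↔ x ∈ N := by
    intro x
    by_cases hx : x ∈ N
    · simp [e, Equiv.sumCompl_symm_apply_of_pos, hx]
    · simp [e, Equiv.sumCompl_symm_apply_of_neg, hx]
  refine ⟨⟨e, fun {p q} => ?_⟩⟩
  rw [extremalGraph_adj, heN, heN, ← hev, e.injective.ne_iff, e.injective.eq_iff,
    e.injective.eq_iff]
  rfl

-- Test vector: 1 off v and ε at v. With ε = 0 it sees only the clique on n - 1 vertices; a small ε
-- > 0 gains 2ε|N| at a cost of order ε².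
open Classical in
lemma sub_two_le_adjSpectralRadius_nearComplete {v : V} {N : Finset V} (hv : v ∉ N) :
    (Fintype.card V : ℝ) - 2 ≤ (nearComplete v N).adjSpectralRadius ∧
      (2 ≤ Fintype.card V → N.Nonempty →
        (Fintype.card V : ℝ) - 2 < (nearComplete v N).adjSpectralRadius) := by
  have : Nonempty V := ⟨v⟩
  set H := nearComplete v N with hH
  set n : ℝ := (Fintype.card V : ℝ) with hn
  have hn1 : 1 ≤ n := by
    rw [hn]; exact_mod_cast Fintype.card_pos (α := V)
  have key : ∀ ε : ℝ, (n - 1) * (n - 2) + 2 * ε * N.card ≤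
      H.adjSpectralRadius * (n - 1 + ε ^ 2) := by
    intro ε
    set y : V → ℝ := fun u => if u = v then ε else 1 with hy
    have hyv : y v = ε := by simp [hy]
    have hy1 : ∀ u, u ≠ v → y u = 1 := fun u hu => by simp [hy, hu]
    have hcv : ((Finset.univ.erase v).card : ℝ) = n - 1 := by
      rw [Finset.cast_card_erase_of_mem (Finset.mem_univ v), Finset.card_univ]
    have htot : ∑ u, y u = n - 1 + ε := by
      rw [← Finset.add_sum_erase _ _ (Finset.mem_univ v), hyv,
        Finset.sum_congr rfl fun u hu => hy1 u (Finset.ne_of_mem_erase hu)]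
      simp only [Finset.sum_const, nsmul_eq_mul, hcv]
      ring
    have hyy : y ⬝ᵥ y = n - 1 + ε ^ 2 := by
      rw [dotProduct, ← Finset.add_sum_erase _ _ (Finset.mem_univ v), hyv,
        Finset.sum_congr rfl fun u hu => by rw [hy1 u (Finset.ne_of_mem_erase hu)]]
      simp only [Finset.sum_const, nsmul_eq_mul, hcv]
      ring
    have hAv : (H.adjMatrix ℝ *ᵥ y) v = N.card := by
      rw [adjMatrix_mulVec_apply]
      have : H.neighborFinset v = N := by
        ext w
        simp only [mem_neighborFinset, hH, nearComplete]
        constructor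
        · exact fun h => h.2.1 trivial
        · exact fun h => ⟨fun h' => hv (h' ▸ h), fun _ => h, fun h' => absurd (h' ▸ h) hv⟩
      rw [this, Finset.sum_congr rfl fun u hu => hy1 u (fun h => hv (h ▸ hu))]
      simp
    have hAu : ∀ u, u ≠ v → (H.adjMatrix ℝ *ᵥ y) u = n - 2 + if u ∈ N then ε else 0 := by
      intro u hu
      rw [adjMatrix_mulVec_apply]
      have hsum : ∑ w ∈ Finset.univ.erase u, y w = n - 2 + ε := by
        have := Finset.add_sum_erase Finset.univ y (Finset.mem_univ u)
        rw [htot, hy1 u hu] at this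
        linarith
      split_ifs with huN
      · have : H.neighborFinset u = Finset.univ.erase u := by
          ext w
          simp only [mem_neighborFinset, hH, nearComplete, Finset.mem_erase, Finset.mem_univ]
          grind
        rw [this, hsum]
      · have : H.neighborFinset u = (Finset.univ.erase u).erase v := by
          ext w
          simp only [mem_neighborFinset, hH, nearComplete, Finset.mem_erase, Finset.mem_univ]
          grind
        rw [this]
        have := Finset.add_sum_erase (Finset.univ.erase u) y
          (Finset.mem_erase.mpr ⟨hu.symm, Finset.mem_univ v⟩)
        rw [hsum, hyv] at this
        linarith
    have hQ : y ⬝ᵥ H.adjMatrix ℝ *ᵥ y = (n - 1) * (n - 2) + 2 * ε * N.card := by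
      rw [dotProduct, ← Finset.add_sum_erase _ _ (Finset.mem_univ v), hyv, hAv,
        Finset.sum_congr rfl fun u hu => by
          rw [hy1 u (Finset.ne_of_mem_erase hu), hAu u (Finset.ne_of_mem_erase hu), one_mul]]
      rw [Finset.sum_add_distrib, Finset.sum_const, nsmul_eq_mul, hcv, ← Finset.sum_filter,
        Finset.sum_const, nsmul_eq_mul]
      have : (Finset.univ.erase v).filter (· ∈ N) = N := by
        ext w
        simp only [Finset.mem_filter, Finset.mem_erase, Finset.mem_univ]
        grind
      rw [this]
      ring
    have := H.exists_nonneg_top_eigenvector.1 y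
    rwa [hQ, hyy] at this
  have h0 := key 0
  have hge : n - 2 ≤ H.adjSpectralRadius := by
    rcases hn1.eq_or_lt with h1 | h1
    · have := H.exists_nonneg_top_eigenvector.1 (fun _ => 1)
      have h2 : (0 : ℝ) ≤ (fun _ => (1 : ℝ)) ⬝ᵥ H.adjMatrix ℝ *ᵥ (fun _ => 1) := by
        refine Finset.sum_nonneg fun u _ => mul_nonneg zero_le_one ?_
        rw [adjMatrix_mulVec_apply]
        exact Finset.sum_nonneg fun _ _ => zero_le_one
      have h3 : (fun _ => (1 : ℝ)) ⬝ᵥ (fun _ : V => (1 : ℝ)) = n := by simp [dotProduct, hn]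
      rw [h3, ← h1] at this
      linarith
    · have : 0 < n - 1 := by linarith
      refine le_of_mul_le_mul_right ?_ this
      linarith
  refine ⟨hge, fun hn2 hNe => lt_of_le_of_ne hge fun heq => ?_⟩
  have h2 : 2 ≤ n := by rw [hn]; exact_mod_cast hn2
  have hN1 : (1 : ℝ) ≤ N.card := by exact_mod_cast hNe.card_pos
  -- With ε = 1/n the cost (n-2)ε² is at most ε, less than the gain 2ε|N|.
  have h := key (1 / n)
  rw [← heq] at h
  have hε : 0 < 1 / n := by positivity
  have h3 : (n - 2) * (1 / n) ≤ 1 := by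
    rw [mul_one_div, div_le_one (by linarith)]
    linarith
  nlinarith

open Classical in
/-- A proper spanning subgraph of `nearComplete v N` has smaller spectral radius. -/
lemma eq_nearComplete_of_le {G : SimpleGraph V} {v : V} {N : Finset V} (hv : v ∉ N)
    (hle : G ≤ nearComplete v N)
    (hρ : (nearComplete v N).adjSpectralRadius ≤ G.adjSpectralRadius) :
    G = nearComplete v N := by
  have : Nonempty V := ⟨v⟩
  set H := nearComplete v N with hH
  refine le_antisymm hle fun p q hpq => ?_
  by_contra hG
  obtain ⟨x, hx, hx0, hev⟩ := G.exists_nonneg_top_eigenvector.2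
  have hray := H.exists_nonneg_top_eigenvector.1
  have hmono : ∀ u, (G.adjMatrix ℝ *ᵥ x) u ≤ (H.adjMatrix ℝ *ᵥ x) u := by
    intro u
    rw [adjMatrix_mulVec_apply, adjMatrix_mulVec_apply]
    exact Finset.sum_le_sum_of_subset_of_nonneg
      (fun w hw => by simpa using hle (by simpa using hw)) fun w _ _ => hx w
  have hxx : 0 ≤ x ⬝ᵥ x := Finset.sum_nonneg fun i _ => mul_self_nonneg _
  have hGQ : x ⬝ᵥ G.adjMatrix ℝ *ᵥ x = G.adjSpectralRadius * (x ⬝ᵥ x) := by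
    rw [hev, dotProduct_smul, smul_eq_mul]
  have hGH : x ⬝ᵥ G.adjMatrix ℝ *ᵥ x ≤ x ⬝ᵥ H.adjMatrix ℝ *ᵥ x :=
    Finset.sum_le_sum fun u _ => mul_le_mul_of_nonneg_left (hmono u) (hx u)
  have hHQ : x ⬝ᵥ H.adjMatrix ℝ *ᵥ x = H.adjSpectralRadius * (x ⬝ᵥ x) := by
    refine le_antisymm (hray x) ?_
    nlinarith
  have hevH := mulVec_eq_smul_of_rayleigh_max (H.isSymm_adjMatrix (α := ℝ)) hray hHQ
  have hpos : 0 < x ⬝ᵥ x := lt_of_le_of_ne hxx fun h => hx0 (dotProduct_self_eq_zero.mp h.symm)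
  have hρeq : G.adjSpectralRadius = H.adjSpectralRadius :=
    le_antisymm (le_of_mul_le_mul_right (by linarith) hpos) hρ
  have hevH' : ∀ u, ∑ w ∈ H.neighborFinset u, x w = H.adjSpectralRadius * x u := fun u => by
    have := congrFun hevH u
    rwa [adjMatrix_mulVec_apply] at this
  -- x is a top eigenvector of both graphs, so an edge of H missing from G carries no weight at
  -- either end. Zeros then spread along edges of H.
  have hzero : ∀ p q, H.Adj p q → ¬ G.Adj p q → x q = 0 := by
    intro p q hpq hG
    have h1 : ∑ w ∈ G.neighborFinset p, x w = ∑ w ∈ H.neighborFinset p, x w := by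
      rw [← adjMatrix_mulVec_apply, ← adjMatrix_mulVec_apply, hev, hevH, hρeq]
    have hsub : insert q (G.neighborFinset p) ⊆ H.neighborFinset p := by
      intro w hw
      rcases Finset.mem_insert.mp hw with rfl | hw
      · simpa using hpq
      · simpa using hle (by simpa using hw)
    have h2 := Finset.sum_le_sum_of_subset_of_nonneg hsub (f := x) fun w _ _ => hx w
    rw [Finset.sum_insert (by simpa using hG)] at h2
    linarith [hx q]
  have hnbr : ∀ u w, H.Adj u w → x u = 0 → x w = 0 := by
    intro u w huw hu
    have h := hevH' u
    rw [hu, mul_zero] at h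
    exact (Finset.sum_eq_zero_iff_of_nonneg fun i _ => hx i).mp h w (by simpa using huw)
  have hp0 := hzero q p hpq.symm fun h => hG h.symm
  have hq0 := hzero p q hpq hG
  have hall : ∀ u, u ≠ v → ∀ w, w ≠ v → x u = 0 → x w = 0 := by
    intro u hu w hw hxu
    by_cases huw : u = w
    · exact huw ▸ hxu
    · exact hnbr u w ⟨huw, fun h => absurd h hu, fun h => absurd h hw⟩ hxu
  have hnv : ∀ w, w ≠ v → x w = 0 := by
    intro w hw
    by_cases hpv : p = v
    · exact hall q (fun h => hpq.1 (hpv.trans h.symm)) w hw hq0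
    · exact hall p hpv w hw hp0
  have hxv : x v ≠ 0 := by
    intro h
    apply hx0
    ext w
    by_cases hw : w = v
    · rw [hw, h]; rfl
    · exact hnv w hw
  -- H may be disconnected: x could live on an isolated v alone. That would give ρ = 0, while p, q,
  -- v are three vertices and ρ ≥ n - 2.
  have hiso : ∀ w, ¬ H.Adj w v := fun w hw => hxv (hnbr w v hw (hnv w hw.1))
  have hpv : p ≠ v := fun h => hiso q (h ▸ hpq.symm)
  have hqv : q ≠ v := fun h => hiso p (h ▸ hpq)
  have hρ0 : H.adjSpectralRadius = 0 := by
    have h := hevH' v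
    rw [Finset.sum_eq_zero fun w hw => hnv w fun h => by simp [h] at hw]
      at h
    exact (mul_eq_zero.mp h.symm).resolve_right hxv
  have hcard : 3 ≤ Fintype.card V := by
    have : ({p, q, v} : Finset V).card = 3 := Finset.card_eq_three.mpr
      ⟨p, q, v, hpq.1, hpv, hqv, rfl⟩
    exact this ▸ Finset.card_le_univ _
  have h := (sub_two_le_adjSpectralRadius_nearComplete hv).1
  have h3 : (3 : ℝ) ≤ Fintype.card V := by exact_mod_cast hcard
  rw [← hH, hρ0] at h
  linarith

end SimpleGraph

/-! ### Counting edges around a barrier. -/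

namespace SimpleGraph

variable {V : Type*} [Fintype V]

-- Handshake lemma in the subgraph induced on T; this parity is where the hypothesis that na is even
-- when a = b takes effect.
open Classical in
lemma even_sum_card_neighborFinset_inter (G : SimpleGraph V) (T : Finset V) :
    Even (∑ u ∈ T, (G.neighborFinset u ∩ T).card) := by
  let K : SimpleGraph V :=
    { Adj := fun p q => G.Adj p q ∧ p ∈ T ∧ q ∈ T
      symm := ⟨fun _ _ h => ⟨h.1.symm, h.2.2, h.2.1⟩⟩
      loopless := ⟨fun _ h => G.loopless.irrefl _ h.1⟩ }
  have h := K.sum_degrees_eq_twice_card_edges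
  have hdeg : ∀ u, K.degree u = if u ∈ T then (G.neighborFinset u ∩ T).card else 0 := by
    intro u
    rw [← card_neighborFinset_eq_degree]
    split_ifs with hu
    · congr 1
      ext w
      simp [K, hu]
    · rw [Finset.card_eq_zero]
      ext w
      simp [K, hu]
  simp only [hdeg, Finset.sum_ite_mem, Finset.univ_inter] at h
  rw [h]
  exact even_two_mul _

open Classical in
/-- Splitting the degree sum along disjoint sets `S`, `T` and the rest, of size `r`. -/
lemma sum_degree_le_of_disjoint (G : SimpleGraph V) {S T : Finset V} (hST : Disjoint S T) {r : ℕ}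
    (hr : S.card + T.card + r = Fintype.card V) :
    ∃ Y Z : ℕ, Even Z ∧ ∑ u ∈ T, (G.neighborFinset u \ S).card = Y + Z ∧ Y ≤ T.card * r ∧
      ∑ v, G.degree v + S.card + r ≤ S.card * Fintype.card V +
        (T.card * S.card + ∑ u ∈ T, (G.neighborFinset u \ S).card) +
        (r * S.card + Y + r * r) := by
  set U := (S ∪ T)ᶜ with hU
  have hUr : U.card = r := by
    rw [hU, Finset.card_compl, Finset.card_union_of_disjoint hST]
    omega
  refine ⟨∑ u ∈ T, (G.neighborFinset u ∩ U).card, ∑ u ∈ T, (G.neighborFinset u ∩ T).card,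
    G.even_sum_card_neighborFinset_inter T, ?_, ?_, ?_⟩
  · rw [← Finset.sum_add_distrib]
    refine Finset.sum_congr rfl fun u _ => ?_
    rw [← Finset.card_union_of_disjoint]
    · congr 1
      ext w
      have hw : w ∈ S → w ∉ T := fun h => Finset.disjoint_left.mp hST h
      simp only [hU, Finset.mem_sdiff, Finset.mem_union, Finset.mem_inter, Finset.mem_compl]
      tauto
    · rw [Finset.disjoint_left]
      intro w
      simp only [hU, Finset.mem_union, Finset.mem_inter, Finset.mem_compl]
      tauto
  · rw [← hUr, ← smul_eq_mul]
    exact Finset.sum_le_card_nsmul _ _ _ fun u _ => Finset.card_le_card Finset.inter_subset_right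
  · have hsplit : ∑ v, G.degree v = ∑ v ∈ S, G.degree v + ∑ v ∈ T, G.degree v +
        ∑ v ∈ U, G.degree v := by
      rw [← Finset.sum_union hST, hU, Finset.sum_add_sum_compl]
    have hswap : ∑ u ∈ T, (G.neighborFinset u ∩ U).card =
        ∑ u ∈ U, (G.neighborFinset u ∩ T).card := by
      have h1 : ∀ (A : Finset V) u, (G.neighborFinset u ∩ A).card =
          ∑ w ∈ A, if G.Adj u w then 1 else 0 := by
        intro A u
        rw [Finset.sum_boole, Nat.cast_id]
        congr 1
        ext w
        simp [and_comm]
      simp only [h1]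
      rw [Finset.sum_comm]
      simp only [G.adj_comm]
    have hS : ∑ v ∈ S, G.degree v + S.card ≤ S.card * Fintype.card V := by
      rw [Finset.card_eq_sum_ones, ← Finset.sum_add_distrib, ← Finset.card_eq_sum_ones,
        ← smul_eq_mul]
      exact Finset.sum_le_card_nsmul _ _ _ fun u _ => G.degree_lt_card_verts u
    have hT : ∑ v ∈ T, G.degree v ≤
        T.card * S.card + ∑ u ∈ T, (G.neighborFinset u \ S).card := by
      rw [← smul_eq_mul, ← Finset.sum_const, ← Finset.sum_add_distrib]
      refine Finset.sum_le_sum fun u _ => ?_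
      rw [← card_neighborFinset_eq_degree, add_comm]
      exact Finset.card_le_card_sdiff_add_card
    have hUU : ∑ v ∈ U, G.degree v + r ≤
        r * S.card + ∑ u ∈ U, (G.neighborFinset u ∩ T).card + r * r := by
      have : ∀ v ∈ U, G.degree v + 1 ≤ S.card + (G.neighborFinset v ∩ T).card + r := by
        intro v hv
        have hsub : G.neighborFinset v ⊆ S ∪ (G.neighborFinset v ∩ T) ∪ U.erase v := by
          intro w hw
          have hne : w ≠ v := by
            rintro rfl
            simp at hw
          simp only [hU, Finset.mem_union, Finset.mem_inter, Finset.mem_erase, Finset.mem_compl]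
          tauto
        have h1 := Finset.card_le_card hsub
        have h2 := Finset.card_union_le (S ∪ (G.neighborFinset v ∩ T)) (U.erase v)
        have h3 := Finset.card_union_le S (G.neighborFinset v ∩ T)
        have h4 := Finset.card_erase_add_one hv
        rw [card_neighborFinset_eq_degree] at h1
        omega
      have h := Finset.sum_le_sum this
      simp only [Finset.sum_add_distrib, Finset.sum_const, smul_eq_mul, hUr, mul_one] at h
      exact h
    rw [hsplit, hswap]
    linarith

/-- The arithmetic core: a barrier `(S, T)` with `S` nonempty forces few edges. -/
lemma degree_sum_bound_of_barrier {a b n s t r X Y Z D : ℕ} (ha : 1 ≤ a) (hab : a ≤ b)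
    (hpar : a = b → Even (n * a)) (hn : s + t + r = n) (hs : 1 ≤ s) (hat : a + 1 ≤ t)
    (hX : b * s + X < a * t) (hXY : X = Y + Z) (hZ : Even Z) (hY : Y ≤ t * r)
    (hD : D + s + r ≤ s * n + (t * s + X) + (r * s + Y + r * r)) :
    (D : ℤ) ≤ (n - 1) * (n - 2) + a ∧ (a = 1 → (D : ℤ) ≤ (n - 1) * (n - 2)) := by
  have has : a * s ≤ b * s := Nat.mul_le_mul_right _ hab
  have hst : s + 1 ≤ t := by
    by_contra h
    have : a * t ≤ a * s := Nat.mul_le_mul_left _ (by omega)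
    omega
  -- One unit better than the barrier inequality. If a = b, then X = Z and a(s + t) = na are even,
  -- so the gap is even; if a < b, then bs ≥ as + s supplies the unit.
  have hpar' : r = 0 → X + a * s + 2 ≤ a * t := by
    rintro rfl
    rcases hab.eq_or_lt with rfl | h
    · obtain ⟨z, hz⟩ := hZ
      obtain ⟨m, hm⟩ := hpar rfl
      have h1 : a * s + a * t = m + m := by rw [← hm, ← hn]; ring
      have h2 : Y = 0 := by simpa using hY
      omega
    · have : (a + 1) * s ≤ b * s := Nat.mul_le_mul_right _ h
      rw [add_mul] at this
      omega
  have hX' : X + a * s + 1 ≤ a * t := by omega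
  have hYX : Y ≤ X := by omega
  subst hn
  clear hX hXY hpar hZ
  zify at *
  -- Start from K_n, delete all pairs inside T and between T and the rest, and restore the actual
  -- ones, which contribute Z + 2Y = X + Y.
  have e0 : (D : ℤ) ≤ (s + t + r) * (s + t + r - 1) - t * (t - 1) - 2 * t * r + X + Y := by
    nlinarith
  by_cases ha1 : a = 1
  · subst ha1
    suffices h : (D : ℤ) ≤ (s + t + r - 1) * (s + t + r - 2) from
      ⟨by push_cast; linarith, fun _ => h⟩
    push_cast at *
    by_cases hr : r = 0
    · have := hpar' (by exact_mod_cast hr)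
      subst hr
      push_cast at *
      nlinarith [sq_nonneg ((t : ℤ) - 2), sq_nonneg ((t : ℤ) - 3)]
    · have hr1 : (1 : ℤ) ≤ r := by exact_mod_cast Nat.one_le_iff_ne_zero.mpr hr
      nlinarith [sq_nonneg ((t : ℤ) - 2), mul_nonneg (sub_nonneg.mpr hr1) (by linarith : (0 : ℤ) ≤ t - 1)]
  · refine ⟨?_, fun h => absurd (by exact_mod_cast h) ha1⟩
    have ha2 : (2 : ℤ) ≤ a := by
      have : 2 ≤ a := by
        have : (1 : ℤ) ≤ a := ha
        omega
      exact_mod_cast this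
    -- Exactly the slack in the tightest case t = a + 1, r = 0, once the extra unit of `hpar'` is
    -- used.
    have h1 : 0 ≤ ((a : ℤ) - 2) * (s - 1) := mul_nonneg (by linarith) (by linarith)
    by_cases ht : (a : ℤ) + 2 ≤ t
    · have h2 : 0 ≤ ((t : ℤ) - 2) * r := mul_nonneg (by linarith) (by positivity)
      nlinarith [mul_nonneg (sub_nonneg.mpr ht) (by linarith : (0 : ℤ) ≤ t - 1)]
    · have hte : (t : ℤ) = a + 1 := by linarith
      by_cases hr : r = 0
      · have h3 := hpar' (by exact_mod_cast hr)
        subst hr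
        rw [hte] at *
        push_cast at *
        nlinarith
      · have hr1 : (1 : ℤ) ≤ r := by exact_mod_cast Nat.one_le_iff_ne_zero.mpr hr
        have h2 := mul_nonneg (sub_nonneg.mpr hr1) (by linarith : (0 : ℤ) ≤ t - 2)
        rw [hte] at *
        nlinarith

open Classical in
lemma not_hasFractionalFactor_extremalGraph_iso {G : SimpleGraph V} {n a b : ℕ} (ha : 1 ≤ a)
    (e : G ≃g extremalGraph n a) : ¬ G.HasFractionalFactor a b := by
  rintro ⟨h, F, hF⟩
  set v := e.symm (.inr (.inr 0)) with hv
  have hdeg : G.degree v ≤ a - 1 := by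
    have hsub : (G.neighborFinset v).image e ⊆ Finset.univ.image Sum.inl := by
      intro w hw
      obtain ⟨u, hu, rfl⟩ := Finset.mem_image.mp hw
      have hadj : (extremalGraph n a).Adj (e v) (e u) := e.map_adj_iff.mpr (by simpa using hu)
      rw [hv, e.apply_symm_apply, extremalGraph_adj] at hadj
      obtain ⟨i, hi⟩ := Sum.isLeft_iff.mp (hadj.2.1 rfl)
      exact Finset.mem_image.mpr ⟨i, Finset.mem_univ i, hi.symm⟩
    have h1 := Finset.card_le_card hsub
    rw [Finset.card_image_of_injective _ e.injective, card_neighborFinset_eq_degree] at h1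
    exact h1.trans (Finset.card_image_le.trans (by simp))
  have hlow := hF.lower v
  have hup : ∑ e ∈ Finset.univ.filter (fun e : G.edgeSet => v ∈ e.1), h e ≤ G.degree v := by
    refine (Finset.sum_le_sum fun e _ => (hF.mem_Icc e).2).trans_eq ?_
    rw [G.sum_edgeSet_filter_mem (fun _ => 1)]
    simp
  have : (a : ℝ) ≤ G.degree v := hlow.trans hup
  have : a ≤ G.degree v := by exact_mod_cast this
  omega

end SimpleGraph

/-! ### The main theorem. -/

open SimpleGraph

theorem theorem1p3 {V : Type*} [Fintype V] (G : SimpleGraph V) (n a b : ℕ)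
    (ha : 1 ≤ a) (hab : a ≤ b) (hcard : Fintype.card V = n) (hn : a + 1 ≤ n)
    (hpar : a = b → Even (n * a))
    (hρ : (SimpleGraph.extremalGraph n a).adjSpectralRadius ≤ G.adjSpectralRadius) :
    G.HasFractionalFactor a b ↔ ¬ Nonempty (G ≃g SimpleGraph.extremalGraph n a) := by
  classical
  refine ⟨fun h ⟨e⟩ => not_hasFractionalFactor_extremalGraph_iso ha e h, fun hiso => ?_⟩
  by_contra hG
  have : Nonempty V := Fintype.card_pos_iff.mp (by omega)
  have hρH : ∀ (v : V) (N : Finset V), v ∉ N → N.card = a - 1 →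
      (nearComplete v N).adjSpectralRadius ≤ G.adjSpectralRadius := by
    intro v N hv hN
    obtain ⟨e⟩ := nonempty_nearComplete_iso_extremalGraph ha hcard hv hN
    have : Nonempty (Fin (a - 1) ⊕ (Fin (n - a) ⊕ Fin 1)) := ⟨.inr (.inr 0)⟩
    exact (adjSpectralRadius_le_of_iso e.symm).trans hρ
  have hmin : ∀ v, a ≤ G.degree v := by
    intro v
    by_contra! hlt
    -- Pad the neighbourhood of v to exactly a - 1 vertices, so that G lies in a copy of the
    -- extremal graph.
    obtain ⟨N, hsub, hNv, hN⟩ := Finset.exists_subsuperset_card_eq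
      (s := G.neighborFinset v) (t := Finset.univ.erase v) (n := a - 1)
      (fun w hw => Finset.mem_erase.mpr ⟨fun h => by simp [h] at hw, Finset.mem_univ w⟩)
      (by rw [card_neighborFinset_eq_degree]; omega)
      (by rw [Finset.card_erase_of_mem (Finset.mem_univ v), Finset.card_univ]; omega)
    have hv : v ∉ N := fun h => by simpa using hNv h
    have hle : G ≤ nearComplete v N := fun p q hpq =>
      ⟨hpq.ne, fun h => hsub (by simpa [← h] using hpq), fun h => hsub (by simpa [← h] using hpq.symm)⟩
    have heq := eq_nearComplete_of_le hv hle (hρH v N hv hN)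
    exact hiso (heq ▸ nonempty_nearComplete_iso_extremalGraph ha hcard hv hN)
  obtain ⟨S, T, hST, hbar⟩ := G.exists_barrier_of_not_hasFractionalFactor hab hG
  -- Against the barrier inequality this yields b|S| < |T||S|, hence both |T| > b and S nonempty.
  have hTdeg : a * T.card ≤ T.card * S.card + ∑ u ∈ T, (G.neighborFinset u \ S).card := by
    rw [mul_comm, ← smul_eq_mul, ← smul_eq_mul, ← Finset.sum_const, ← Finset.sum_const,
      ← Finset.sum_add_distrib]
    refine Finset.sum_le_sum fun u _ => (hmin u).trans ?_
    rw [← card_neighborFinset_eq_degree, add_comm]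
    exact Finset.card_le_card_sdiff_add_card
  have hlt : b * S.card < T.card * S.card := by omega
  have hbT : b < T.card := lt_of_mul_lt_mul_right hlt (Nat.zero_le _)
  have hS : 1 ≤ S.card := Nat.pos_of_ne_zero fun h => by simp [h] at hlt
  obtain ⟨r, hr⟩ := Nat.exists_eq_add_of_le
    ((Finset.card_union_of_disjoint hST).symm.trans_le (Finset.card_le_univ (S ∪ T)))
  obtain ⟨Y, Z, hZ, hXY, hY, hD⟩ := G.sum_degree_le_of_disjoint hST hr.symm
  have hbound := degree_sum_bound_of_barrier ha hab hpar (hr.symm.trans hcard) hS (by omega) hbar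
    hXY hZ hY (hcard ▸ hD)
  have hsq := G.adjSpectralRadius_sq_le hmin
  rw [hcard] at hsq
  obtain ⟨v⟩ := ‹Nonempty V›
  obtain ⟨N, hNv, hN⟩ := Finset.exists_subset_card_eq (s := Finset.univ.erase v) (n := a - 1)
    (by rw [Finset.card_erase_of_mem (Finset.mem_univ v), Finset.card_univ]; omega)
  have hv : v ∉ N := fun h => by simpa using hNv h
  have hlow := sub_two_le_adjSpectralRadius_nearComplete hv
  rw [hcard] at hlow
  have hle := hρH v N hv hN
  set ρ := G.adjSpectralRadius
  have hnR : (a : ℝ) + 1 ≤ n := by exact_mod_cast hn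
  have haR : (1 : ℝ) ≤ a := by exact_mod_cast ha
  -- At x = n - 2 the value of x² - (a-1)x is (n-2)(n-1-a), exactly the upper bound from degree sum
  -- (n-1)(n-2) + a. So ρ > n - 2 is needed strictly for a ≥ 2; for a = 1, N is empty and the
  -- sharper degree sum is used.
  rcases ha.eq_or_lt with h1 | h2
  · have hD1 : ∑ v, (G.degree v : ℝ) ≤ (n - 1) * (n - 2) := by exact_mod_cast hbound.2 h1.symm
    have hρ2 : (n : ℝ) - 2 ≤ ρ := hlow.1.trans hle
    subst h1
    push_cast at *
    nlinarith
  · have hD2 : ∑ v, (G.degree v : ℝ) ≤ (n - 1) * (n - 2) + a := by exact_mod_cast hbound.1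
    have hρ2 : (n : ℝ) - 2 < ρ :=
      (hlow.2 (by omega) (Finset.card_pos.mp (by omega))).trans_le hle
    have ha2 : (2 : ℝ) ≤ a := by exact_mod_cast h2
    nlinarith [mul_pos (sub_pos.mpr hρ2) (by linarith : (0 : ℝ) < ρ + (n - 2) - (a - 1))]
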